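/- Let $\kappa$ be an infinite cardinal. All graphs are simple and undirected. A \emph{$\kappa$-graph} is a connected graph with at most $\kappa$ vertices. An \emph{infinite trail} in a graph is an infinite sequence $v_0,v_1,v_2,\dots$ of vertices such that $v_nv_{n+1}$ is an edge for every $n$ and these edges are pairwise distinct (vertices may repeat). Ranks are defined recursively: a graph has rank $0$ iff it is finite; for an ordinal $\alpha>0$, a graph $G$ has rank $\alpha$ iff it has no smaller rank and there is a finite subgraph $F\subseteq G$ such that every connected component of $G-F$ has rank smaller than $\alpha$. Let $\mathbf B_\kappa$ be the class of $\kappa$-graphs without infinite trails and, for an ordinal $\alpha$, let $\mathbf B_\kappa^\alpha$ be the class of those $G\in\mathbf B_\kappa$ that have rank strictly less than $\alpha$. A \emph{strong immersion} $\Phi:G\to H$ is an isomorphism from $G$ onto an induced subgraph of $H$. An \emph{ear} of a subgraph $K$ of $G$ is either a path in $G$ with two distinct ends that meets $K$ in exactly its two end vertices and uses no edge of $K$, or a cycle in $G$ that meets $K$ in exactly one vertex. For a class $\mathcal C$ of graphs, $\mathrm{Stc}(\mathcal C)$ is the least cardinality of a family $\mathcal F\subseteq\mathcal C$ such that every $G\in\mathcal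 C$ has a strong immersion into some $H\in\mathcal F$. \textbf{Theorem.} For every ordinal $\alpha$ with $0<\alpha<\kappa^+$ there is a family $\mathcal F_\kappa^\alpha\subseteq\mathbf B_\kappa^\alpha$ such that (1) for every $G\in\mathbf B_\kappa^\alpha$ and every finite subgraph $K\subseteq G$ there are $H\in\mathcal F_\kappa^\alpha$ and a strong immersion $\Phi:G\to H$ such that, if there is no ear of $K$ in $G$, then there is no ear of $\Phi[K]$ in $H$; (2) $|\mathcal F_\kappa^\alpha|\le\kappa$. Moreover, $\mathrm{Stc}(\mathbf B_\kappa)=\kappa^+$. -/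

import Mathlib

open Cardinal

universe u

/-- A (simple, undirected) graph together with its vertex type. -/
structure BundledGraph : Type (u + 1) where
  /-- The vertex type. -/
  V : Type u
  /-- The adjacency structure. -/
  graph : SimpleGraph V

/-- `HasRank α G`: the graph `G` has rank `α` in the rayless hierarchy.
A graph has rank `0` iff it is finite. For `α > 0` it has rank `α` iff it does not have a smaller
rank and there is a finite set `F` of vertices (the vertex set of a kernel) such that every
connected component of `G - F` has rank smaller than `α`. -/
def HasRank (α : Ordinal.{u}) {V : Type u} (G : SimpleGraph V) : Prop :=
  (α = 0 ∧ Finite V) ∨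
  (α ≠ 0 ∧ (∀ β, ∀ _h : β < α, ¬ HasRank β G) ∧
    ∃ F : Set V, F.Finite ∧ ∀ C : (G.induce Fᶜ).ConnectedComponent,
      ∃ β, ∃ _h : β < α, HasRank β C.toSimpleGraph)
termination_by α

/-- An infinite trail: an infinite sequence of consecutively adjacent vertices (with a first
vertex) that may repeat vertices but never traverses the same edge twice. -/
def IsInfiniteTrail {V : Type u} (G : SimpleGraph V) (v : ℕ → V) : Prop :=
  (∀ n, G.Adj (v n) (v (n + 1))) ∧ Function.Injective fun n => s(v n, v (n + 1))

/-- The class of `κ`-graphs without infinite trails: connected graphs with at most `κ` vertices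
that contain no infinite trail. -/
def trailFree (κ : Cardinal.{u}) : Set BundledGraph.{u} :=
  {G | G.graph.Connected ∧ #G.V ≤ κ ∧ ¬ ∃ v : ℕ → G.V, IsInfiniteTrail G.graph v}

/-- The subclass of `trailFree κ` of the graphs of rank strictly less than `α`. -/
def trailFreeBelow (κ : Cardinal.{u}) (α : Ordinal.{u}) : Set BundledGraph.{u} :=
  {G | G ∈ trailFree κ ∧ ∃ β < α, HasRank β G.graph}

/-- There is an open ear of `K` in `G`: a path of `G` between two distinct vertices of `K` that
meets `K` in exactly its two ends (and, as usual, does not use an edge of `K`). -/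
def HasOpenEar {V : Type u} {G : SimpleGraph V} (K : G.Subgraph) : Prop :=
  ∃ (u v : V) (p : G.Walk u v), p.IsPath ∧ u ≠ v ∧
    (∀ w ∈ p.support, w ∈ K.verts ↔ w = u ∨ w = v) ∧ ∀ e ∈ p.edges, e ∉ K.edgeSet

/-- There is a closed ear of `K` in `G`: a cycle of `G` that meets `K` in exactly one vertex (at
which, without loss of generality, the cycle is based). -/
def HasClosedEar {V : Type u} {G : SimpleGraph V} (K : G.Subgraph) : Prop :=
  ∃ (u : V) (c : G.Walk u u), c.IsCycle ∧ ∀ w ∈ c.support, w ∈ K.verts ↔ w = u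

/-- There is an ear (open or closed) of `K` in `G`. -/
def HasEar {V : Type u} {G : SimpleGraph V} (K : G.Subgraph) : Prop :=
  HasOpenEar K ∨ HasClosedEar K

/-- A family `F` is strongly universal in the class `𝒞` if `F ⊆ 𝒞` and every member of `𝒞` has a
strong immersion (an isomorphism onto an induced subgraph) into some member of `F`. -/
def IsStronglyUniversal (F 𝒞 : Set BundledGraph.{u}) : Prop :=
  F ⊆ 𝒞 ∧ ∀ G ∈ 𝒞, ∃ H ∈ F, Nonempty (G.graph ↪g H.graph)

/-- The strong complexity of a class: the least cardinality of a strongly universal family. (If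
there is none, the value is `0`; a nonzero value is always attained.) -/
noncomputable def strongComplexity (𝒞 : Set BundledGraph.{u}) : Cardinal.{u + 1} :=
  sInf {c | ∃ F : Set BundledGraph.{u}, IsStronglyUniversal F 𝒞 ∧ #F = c}

/-!
If `G` has no infinite trail, then walking along an edge and deleting it is a well-founded relation
on pairs of a spanning subgraph of `G` and one of its vertices. Induction along it puts any finite
vertex set of a connected `G` into a finite connected `X` such that every component of `G - X` is
joined to `X` by a single edge; it also bounds the rank of `G`, since by regularity of `κ⁺` a
supremum of at most `κ` ranks below `κ⁺` stays below `κ⁺`.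

If moreover `G` has rank at most `α`, then `X` can be chosen so that the components of `G - X` have
rank less than `α`. So `G` arises from the finite connected graph `G[X]` by attaching members of
`𝐁_κ^α` by bridges, and it embeds into the graph obtained from `G[X]` by attaching `κ` copies of
every member of a universal family for `𝐁_κ^α`, in all possible ways. A trail with ends in
the base graph cannot return across a bridge, so an ear of the image of some `K ⊆ X` already lies in
the image of `G[X]`.

The family for `𝐁_κ` has `κ⁺` members, one group of at most `κ` for each rank below `κ⁺`. Fewer do
not suffice: given at most `κ` members of `𝐁_κ`, let `G` contain infinitely many disjoint copies of
each. If `G` embedded into a member `H`, a finite kernel of `H` would miss one of infinitely many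
disjoint copies of `H` inside `H`, so `H` would have a smaller rank than itself.
-/

open SimpleGraph

section Rank

/-- The graph `G` has a rank in the rayless hierarchy, and this rank is less than `α`. -/
def RankLT (α : Ordinal.{u}) {V : Type u} (G : SimpleGraph V) : Prop :=
  ∃ β < α, HasRank β G

variable {α β : Ordinal.{u}} {V W : Type u} {G : SimpleGraph V} {H : SimpleGraph W}

theorem RankLT.mono (h : RankLT α G) (hαβ : α ≤ β) : RankLT β G :=
  let ⟨γ, hγ, hG⟩ := h
  ⟨γ, hγ.trans_le hαβ, hG⟩

theorem rankLT_iff_exists_rankLT_succ : RankLT α G ↔ ∃ β < α, RankLT (Order.succ β) G :=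
  ⟨fun ⟨β, hβ, h⟩ => ⟨β, hβ, β, Order.lt_succ β, h⟩,
    fun ⟨_, hβ, h⟩ => h.mono (Order.succ_le_of_lt hβ)⟩

theorem rankLT_succ_iff_forall_component :
    RankLT (Order.succ α) G ↔
      ∃ F : Set V, F.Finite ∧ ∀ C : (G.induce Fᶜ).ConnectedComponent, RankLT α C.toSimpleGraph := by
  constructor
  · rintro ⟨β, hβ, h⟩
    rw [HasRank] at h
    rcases h with ⟨-, hfin⟩ | ⟨-, -, F, hF, hC⟩
    · refine ⟨Set.univ, Set.toFinite _, fun C => ?_⟩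
      obtain ⟨x, -⟩ := C.nonempty_supp
      exact absurd (Set.mem_univ x.1) x.2
    · refine ⟨F, hF, fun C => ?_⟩
      obtain ⟨γ, hγ, h⟩ := hC C
      exact ⟨γ, hγ.trans_le (Order.lt_succ_iff.1 hβ), h⟩
  · rintro ⟨F, hF, hC⟩
    by_cases hlt : RankLT α G
    · exact hlt.mono (Order.le_succ α)
    refine ⟨α, Order.lt_succ α, ?_⟩
    rw [HasRank]
    rcases eq_or_ne α 0 with rfl | hα
    · have hFuniv : F = Set.univ := Set.eq_univ_iff_forall.2 fun x => by
        by_contra hx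
        obtain ⟨β, hβ, -⟩ := hC ((G.induce Fᶜ).connectedComponentMk ⟨x, hx⟩)
        exact not_lt_bot hβ
      exact Or.inl ⟨rfl, Set.finite_univ_iff.1 (hFuniv ▸ hF)⟩
    · refine Or.inr ⟨hα, fun β hβ h => hlt ⟨β, hβ, h⟩, F, hF, fun C => ?_⟩
      obtain ⟨β, hβ, h⟩ := hC C
      exact ⟨β, hβ, h⟩

theorem isContained_toSimpleGraph {V W : Type*} {G : SimpleGraph V} {H : SimpleGraph W}
    (hH : H.Preconnected) (f : Copy H G) (w : W) :
    H ⊑ (G.connectedComponentMk (f w)).toSimpleGraph :=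
  ⟨⟨⟨fun x => ⟨f x, ConnectedComponent.sound ((hH x w).map f.toHom)⟩, f.toHom.map_rel⟩,
    fun _ _ hxy => f.injective (congrArg Subtype.val hxy)⟩⟩

theorem RankLT.of_isContained (h : RankLT α H) (hGH : G ⊑ H) : RankLT α G := by
  obtain ⟨β, hβ, hrank⟩ := rankLT_iff_exists_rankLT_succ.1 h
  refine RankLT.mono ?_ (Order.succ_le_of_lt hβ)
  clear h hβ
  induction β using WellFoundedLT.induction generalizing V W with
  | ind β ih =>
    rw [rankLT_succ_iff_forall_component] at hrank ⊢
    obtain ⟨F, hF, hrank⟩ := hrank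
    obtain ⟨f⟩ := hGH
    refine ⟨f ⁻¹' F, hF.preimage f.injective.injOn, fun C => ?_⟩
    let g : Copy C.toSimpleGraph (H.induce Fᶜ) :=
      ⟨⟨fun x => ⟨f x.1.1, x.1.2⟩, f.toHom.map_rel⟩, fun _ _ hxy =>
        Subtype.ext (Subtype.ext (f.injective (congrArg Subtype.val hxy)))⟩
    obtain ⟨v, hv⟩ := C.nonempty_supp
    obtain ⟨γ, hγ, h⟩ := rankLT_iff_exists_rankLT_succ.1 (hrank _)
    have hC := isContained_toSimpleGraph C.connected_toSimpleGraph.preconnected g ⟨v, hv⟩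
    exact (ih γ hγ hC h).mono (Order.succ_le_of_lt hγ)

theorem rankLT_succ_iff_forall_connected :
    RankLT (Order.succ α) G ↔ ∃ F : Set V, F.Finite ∧
      ∀ {W : Type u} (T : SimpleGraph W), T.Connected → T ⊑ G.induce Fᶜ → RankLT α T := by
  rw [rankLT_succ_iff_forall_component]
  refine exists_congr fun F => and_congr_right fun _ => ⟨fun h W T hT ⟨f⟩ => ?_, fun h C => ?_⟩
  · obtain ⟨w⟩ := hT.nonempty
    exact (h _).of_isContained (isContained_toSimpleGraph hT.preconnected f w)
  · exact h _ C.connected_toSimpleGraph ⟨Copy.induce _ _⟩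

theorem RankLT.of_disjoint_copies {ι : Type*} [Infinite ι] (hH : H.Connected) (f : ι → Copy H G)
    (hf : Pairwise (Function.onFun Disjoint fun i => Set.range (f i)))
    (hG : RankLT (Order.succ α) G) : RankLT α H := by
  obtain ⟨F, hF, hrank⟩ := rankLT_succ_iff_forall_connected.1 hG
  obtain ⟨i, hi⟩ : ∃ i, ∀ w, f i w ∉ F := by
    by_contra! hmeets
    choose w hw using hmeets
    refine Set.infinite_of_injective_forall_mem (f := fun i => f i (w i)) (fun i j hij => ?_) hw hF
    by_contra hne
    exact Set.disjoint_left.1 (hf hne) ⟨w i, rfl⟩ ⟨w j, hij.symm⟩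
  exact hrank H hH
    ⟨⟨⟨fun w => ⟨f i w, hi w⟩, (f i).toHom.map_rel⟩, fun _ _ hxy =>
      (f i).injective (congrArg Subtype.val hxy)⟩⟩

theorem not_rankLT_of_disjoint_copies {ι : Type*} [Infinite ι] (hH : H.Connected)
    (f : ι → Copy H G) (hf : Pairwise (Function.onFun Disjoint fun i => Set.range (f i)))
    (hGH : G ⊑ H) : ¬ RankLT α H := by
  induction α using WellFoundedLT.induction with
  | ind α ih =>
    intro hα
    obtain ⟨β, hβ, h⟩ := rankLT_iff_exists_rankLT_succ.1 hα
    exact ih β hβ (.of_disjoint_copies hH f hf (h.of_isContained hGH))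

end Rank

section AttachedByBridges

/-- Every component of `G - X` is joined to the vertex set `X` by at most one edge. -/
def AttachedByBridges {V : Type*} (G : SimpleGraph V) (X : Set V) : Prop :=
  ∀ ⦃x x' : V⦄, x ∈ X → x' ∈ X → ∀ ⦃y y' : ↥Xᶜ⦄, (G.induce Xᶜ).Reachable y y' →
    G.Adj x y → G.Adj x' y' → x = x' ∧ (y : V) = y'

variable {V : Type*} {G H : SimpleGraph V} {X Y Z : Set V}

theorem exists_edge_entering {a b : V} (p : G.Walk a b) (ha : a ∉ X) (hb : b ∈ X) :
    ∃ y : ↥Xᶜ, ∃ x ∈ X, (G.induce Xᶜ).Reachable ⟨a, ha⟩ y ∧ G.Adj y x ∧ s(↑y, x) ∈ p.edges := by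
  obtain ⟨d, hd, ⟨hy, hreach⟩, hx⟩ := p.exists_boundary_dart
    {z | ∃ hz : z ∉ X, (G.induce Xᶜ).Reachable ⟨a, ha⟩ ⟨z, hz⟩} ⟨ha, .rfl⟩ fun h => h.1 hb
  refine ⟨⟨d.fst, hy⟩, d.snd, ?_, hreach, d.adj, List.mem_map.2 ⟨d, hd, rfl⟩⟩
  by_contra hxX
  exact hx ⟨hxX, hreach.trans (Adj.reachable d.adj)⟩

theorem AttachedByBridges.support_subset (hX : AttachedByBridges G X) {a b : V} (ha : a ∈ X)
    (hb : b ∈ X) {p : G.Walk a b} (hp : p.IsTrail) {z : V} (hz : z ∈ p.support) : z ∈ X := by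
  classical
  by_contra hzX
  obtain ⟨y, x, hx, hzy, hyx, hmem⟩ := exists_edge_entering (p.takeUntil z hz).reverse hzX ha
  obtain ⟨y', x', hx', hzy', hyx', hmem'⟩ := exists_edge_entering (p.dropUntil z hz) hzX hb
  obtain ⟨hxx', hyy'⟩ := hX hx hx' (hzy.symm.trans hzy') hyx.symm hyx'.symm
  rw [Walk.edges_reverse, List.mem_reverse] at hmem
  rw [← hxx', ← hyy'] at hmem'
  have hnodup := hp.edges_nodup
  rw [← p.take_spec hz, Walk.edges_append] at hnodup
  exact List.disjoint_of_nodup_append hnodup hmem hmem'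

theorem AttachedByBridges.eq_of_adj_of_subset (hX : AttachedByBridges G X) (hXZ : X ⊆ Z)
    (hZ : (G.induce Z).Preconnected) {x x' : V} (hx : x ∈ X) (hx' : x' ∈ Z) {y y' : ↥Zᶜ}
    (hyy' : (G.induce Zᶜ).Reachable y y') (hxy : G.Adj x y) (hxy' : G.Adj x' y') :
    x = x' ∧ (y : V) = y' := by
  have hle : Zᶜ ≤ Xᶜ := Set.compl_subset_compl.2 hXZ
  have hyy'X : (G.induce Xᶜ).Reachable ⟨y, hle y.2⟩ ⟨y', hle y'.2⟩ :=
    hyy'.map (G.induceHomOfLE hle).toHom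
  by_cases hx'X : x' ∈ X
  · exact hX hx hx'X hyy'X hxy hxy'
  -- Otherwise `x'` is joined to `x` inside `Z`, so the component of `x'` in `G - X`, which
  -- contains `y`, has an edge to `X` starting in `Z`.
  obtain ⟨p⟩ := hZ ⟨x', hx'⟩ ⟨x, hXZ hx⟩
  obtain ⟨z, w, hw, hx'z, hzw, hmem⟩ :=
    exists_edge_entering (p.map (Embedding.induce Z).toHom) hx'X hx
  have hzZ : (z : V) ∈ Z := by
    have hz := Walk.fst_mem_support_of_mem_edges _ hmem
    rw [Walk.support_map, List.mem_map] at hz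
    obtain ⟨v, -, hv⟩ := hz
    exact hv ▸ v.2
  have hy'x' : (G.induce Xᶜ).Adj ⟨y', hle y'.2⟩ ⟨x', hx'X⟩ := hxy'.symm
  obtain ⟨-, hyz⟩ := hX hx hw (hyy'X.trans (hy'x'.reachable.trans hx'z)) hxy hzw.symm
  exact absurd (hyz ▸ hzZ) y.2

theorem AttachedByBridges.union (hX : AttachedByBridges G X) (hY : AttachedByBridges H Y)
    (hGH : ∀ a, ∀ b ∉ X ∪ Y, G.Adj a b → H.Adj a b) (hXY : (G.induce (X ∪ Y)).Preconnected) :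
    AttachedByBridges G (X ∪ Y) := by
  intro x x' hx hx' y y' hyy' hxy hxy'
  by_cases hxX : x ∈ X
  · exact hX.eq_of_adj_of_subset Set.subset_union_left hXY hxX hx' hyy' hxy hxy'
  by_cases hxX' : x' ∈ X
  · exact (hX.eq_of_adj_of_subset Set.subset_union_left hXY hxX' hx hyy'.symm hxy' hxy).imp
      Eq.symm Eq.symm
  let f : G.induce (X ∪ Y)ᶜ →g H.induce Yᶜ :=
    ⟨fun z => ⟨z, fun h => z.2 (.inr h)⟩, fun {_ b} hab => hGH _ b b.2 hab⟩
  exact hY (hx.resolve_left hxX) (hx'.resolve_left hxX') (hyy'.map f) (hGH _ _ y.2 hxy)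
    (hGH _ _ y'.2 hxy')

end AttachedByBridges

section InfiniteTrail

variable {V W : Type*} {G : SimpleGraph V} {H : SimpleGraph W} {X : Set V} {v : ℕ → V}

theorem isInfiniteTrail_comp_iff (Φ : G ↪g H) :
    IsInfiniteTrail H (Φ ∘ v) ↔ IsInfiniteTrail G v :=
  and_congr (forall_congr' fun _ => Φ.map_rel_iff)
    ((Sym2.map.injective Φ.injective).of_comp_iff fun n => s(v n, v (n + 1)))

theorem not_isInfiniteTrail_of_finite [Finite V] : ¬ IsInfiniteTrail G v :=
  fun h => not_injective_infinite_finite _ h.2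

theorem IsInfiniteTrail.tail (hv : IsInfiniteTrail G v) (m : ℕ) :
    IsInfiniteTrail G fun n => v (m + n) :=
  ⟨fun n => hv.1 (m + n), hv.2.comp (add_right_injective m)⟩

theorem IsInfiniteTrail.exists_isTrail (hv : IsInfiniteTrail G v) {m n : ℕ} (hmn : m ≤ n) :
    ∃ p : G.Walk (v m) (v n), p.IsTrail ∧ ∀ k, m ≤ k → k ≤ n → v k ∈ p.support := by
  suffices ∃ p : G.Walk (v m) (v n), p.IsTrail ∧ (∀ k, m ≤ k → k ≤ n → v k ∈ p.support) ∧
      ∀ e ∈ p.edges, ∃ k < n, s(v k, v (k + 1)) = e from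
    let ⟨p, hp, hsupport, _⟩ := this
    ⟨p, hp, hsupport⟩
  induction n, hmn using Nat.le_induction with
  | base => exact ⟨.nil, .nil, fun k h h' => by simp [le_antisymm h' h], by simp⟩
  | succ n _ ih =>
    obtain ⟨p, hp, hsupport, hedges⟩ := ih
    have hnew : s(v n, v (n + 1)) ∉ p.edges := fun hmem => by
      obtain ⟨k, hk, heq⟩ := hedges _ hmem
      exact hk.ne (hv.2 heq)
    refine ⟨p.concat (hv.1 n), ?_, fun k hk hkn => ?_, fun e he => ?_⟩
    · rw [Walk.isTrail_def, Walk.edges_concat, List.concat_eq_append]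
      exact List.nodup_append_comm.1 (List.nodup_cons.2 ⟨hnew, hp.edges_nodup⟩)
    · rcases hkn.eq_or_lt with rfl | hkn
      · exact Walk.end_mem_support _
      · exact p.support_subset_support_concat _ (hsupport k hk (Nat.le_of_lt_succ hkn))
    · rw [Walk.edges_concat, List.concat_eq_append, List.mem_append, List.mem_singleton] at he
      rcases he with he | rfl
      · obtain ⟨k, hk, heq⟩ := hedges e he
        exact ⟨k, hk.trans n.lt_succ_self, heq⟩
      · exact ⟨n, n.lt_succ_self, rfl⟩

theorem AttachedByBridges.exists_isInfiniteTrail_induce_compl (hX : AttachedByBridges G X)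
    (hfin : X.Finite) (hv : IsInfiniteTrail G v) :
    ∃ w, IsInfiniteTrail (G.induce Xᶜ) w := by
  by_cases hvisits : ∀ m, ∃ n ≥ m, v n ∈ X
  · obtain ⟨m, -, hm⟩ := hvisits 0
    have hmem : ∀ n, v (m + n) ∈ X := fun n => by
      obtain ⟨l, hl, hlX⟩ := hvisits (m + n)
      obtain ⟨p, hp, hsupport⟩ := hv.exists_isTrail ((m.le_add_right n).trans hl)
      exact hX.support_subset hm hlX hp (hsupport _ (m.le_add_right n) hl)
    have := hfin.to_subtype
    exact (not_isInfiniteTrail_of_finite <|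
      (isInfiniteTrail_comp_iff (v := fun n => (⟨v (m + n), hmem n⟩ : X))
        (Embedding.induce X)).1 (hv.tail m)).elim
  · push Not at hvisits
    obtain ⟨m, hm⟩ := hvisits
    exact ⟨fun n => ⟨v (m + n), hm _ (m.le_add_right n)⟩,
      (isInfiniteTrail_comp_iff (Embedding.induce Xᶜ)).1 (hv.tail m)⟩

theorem induction_on_trails {motive : SimpleGraph V → V → Prop}
    (step : ∀ G u, (∀ w, G.Adj u w → motive (G.deleteEdges {s(u, w)}) w) → motive G u)
    (hG : ¬ ∃ v, IsInfiniteTrail G v) (u : V) : motive G u := by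
  let r : SimpleGraph V × V → SimpleGraph V × V → Prop := fun s t =>
    t.1.Adj t.2 s.2 ∧ s.1 = t.1.deleteEdges {s(t.2, s.2)}
  suffices hacc : Acc r (G, u) from hacc.rec (motive := fun s _ => motive s.1 s.2)
    fun (G, u) _ ih => step G u fun w hw => ih (G.deleteEdges {s(u, w)}, w) ⟨hw, rfl⟩
  by_contra hacc
  obtain ⟨f, hf₀, hf⟩ := not_acc_iff_exists_descending_chain.1 hacc
  have hanti : Antitone fun n => (f n).1 := antitone_nat_of_succ_le fun n => by
    rw [(hf n).2]
    exact deleteEdges_le _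
  refine hG ⟨fun n => (f n).2, fun n => ?_, Function.Injective.of_lt_imp_ne fun m n hmn heq => ?_⟩
  · have hadj : (f 0).1.Adj (f n).2 (f (n + 1)).2 := hanti n.zero_le (hf n).1
    rwa [hf₀] at hadj
  · have hadj : (f (m + 1)).1.Adj (f n).2 (f (n + 1)).2 := hanti (Nat.succ_le_of_lt hmn) (hf n).1
    rw [(hf m).2, deleteEdges_adj] at hadj
    exact hadj.2 heq.symm

end InfiniteTrail

section BridgeKernel

/-- `X` is the vertex set of a finite connected kernel of `G` to which every component of `G - X`
is joined by at most one edge. -/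
structure IsBridgeKernel {V : Type*} (G : SimpleGraph V) (X : Set V) : Prop where
  finite : X.Finite
  connected : (G.induce X).Connected
  attached : AttachedByBridges G X

variable {V : Type*} {G H : SimpleGraph V} {X Y : Set V} {u w : V}

theorem adj_deleteEdges_of_notMem {a b : V} (hu : u ∈ X) (hw : w ∈ X) (hb : b ∉ X)
    (h : G.Adj a b) : (G.deleteEdges {s(u, w)}).Adj a b := by
  refine deleteEdges_adj.2 ⟨h, fun heq => hb ?_⟩
  rcases Sym2.eq_iff.1 heq with ⟨-, rfl⟩ | ⟨-, rfl⟩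
  exacts [hw, hu]

/-- The inclusion of `G - u` into `G - uw`. -/
def copyDeleteEdges (G : SimpleGraph V) (u w : V) :
    Copy (G.induce {u}ᶜ) (G.deleteEdges {s(u, w)}) :=
  ⟨⟨Subtype.val, fun {a b} hab => deleteEdges_adj.2 ⟨hab, fun heq => by
    rcases Sym2.eq_iff.1 heq with ⟨h, -⟩ | ⟨-, h⟩
    exacts [a.2 h, b.2 h]⟩⟩, Subtype.val_injective⟩

theorem IsBridgeKernel.singleton (hu : ∀ w, G.Adj u w → G.IsBridge s(u, w)) :
    IsBridgeKernel G {u} := by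
  refine ⟨Set.finite_singleton u, .of_subsingleton, ?_⟩
  rintro x x' rfl rfl y y' hyy' hxy hxy'
  refine ⟨rfl, by_contra fun hne => isBridge_iff.1 (hu y hxy) ?_⟩
  have hadj : (G.deleteEdges {s(x', ↑y)}).Adj x' y' :=
    deleteEdges_adj.2 ⟨hxy', fun heq => hne (Sym2.congr_right.1 heq).symm⟩
  exact hadj.reachable.trans (hyy'.symm.map (copyDeleteEdges G x' y).toHom)

theorem IsBridgeKernel.of_deleteEdges (hX : IsBridgeKernel (G.deleteEdges {s(u, w)}) X)
    (hu : u ∈ X) (hw : w ∈ X) : IsBridgeKernel G X := by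
  refine ⟨hX.finite, hX.connected.mono (comap_monotone _ (deleteEdges_le _)), ?_⟩
  intro x x' hx hx' y y' hyy' hxy hxy'
  exact hX.attached hx hx'
    (hyy'.mono fun _ b => adj_deleteEdges_of_notMem hu hw b.2)
    (adj_deleteEdges_of_notMem hu hw y.2 hxy) (adj_deleteEdges_of_notMem hu hw y'.2 hxy')

theorem IsBridgeKernel.union (hX : IsBridgeKernel G X) (hY : IsBridgeKernel G Y)
    (hXY : (X ∩ Y).Nonempty) : IsBridgeKernel G (X ∪ Y) :=
  have hconn :=
    induce_union_connected hX.connected.preconnected hY.connected.preconnected hXY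
  ⟨hX.finite.union hY.finite, hconn,
    hX.attached.union hY.attached (fun _ _ _ => id) hconn.preconnected⟩

theorem IsBridgeKernel.union_of_deleteEdges (hX : IsBridgeKernel G X)
    (hY : IsBridgeKernel (G.deleteEdges {s(u, w)}) Y) (hu : u ∈ X) (hw : w ∈ Y)
    (huw : G.Adj u w) : IsBridgeKernel G (X ∪ Y) :=
  have hYG := hY.connected.mono (comap_monotone _ (deleteEdges_le _))
  have hconn :=
    connected_induce_union hX.connected.preconnected hYG.preconnected hu hw huw
  ⟨hX.finite.union hY.finite, hconn, hX.attached.union hY.attached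
    (fun _ _ hb => adj_deleteEdges_of_notMem (.inl hu) (.inr hw) hb) hconn.preconnected⟩

theorem exists_isBridgeKernel_of_reachable (hG : ¬ ∃ v, IsInfiniteTrail G v) {v : V}
    (huv : G.Reachable u v) : ∃ X, IsBridgeKernel G X ∧ u ∈ X ∧ v ∈ X := by
  refine induction_on_trails (motive := fun G u => ∀ v, G.Reachable u v →
    ∃ X, IsBridgeKernel G X ∧ u ∈ X ∧ v ∈ X) (fun G u ih v huv => ?_) hG u v huv
  obtain ⟨X, hX, huX⟩ : ∃ X, IsBridgeKernel G X ∧ u ∈ X := by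
    by_cases hbridge : ∀ w, G.Adj u w → G.IsBridge s(u, w)
    · exact ⟨{u}, .singleton hbridge, rfl⟩
    · push Not at hbridge
      obtain ⟨w, huw, hreach⟩ := hbridge
      rw [isBridge_iff, not_not] at hreach
      obtain ⟨X, hX, hwX, huX⟩ := ih w huw _ hreach.symm
      exact ⟨X, hX.of_deleteEdges huX hwX, huX⟩
  by_cases hvu : v = u
  · exact ⟨X, hX, huX, hvu ▸ huX⟩
  obtain ⟨p⟩ := huv.symm
  obtain ⟨w, u', hu', hvw, hwu, -⟩ := exists_edge_entering (X := {u}) p hvu rfl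
  obtain rfl : u = u' := hu'.symm
  obtain ⟨Y, hY, hwY, hvY⟩ := ih w hwu.symm _ (hvw.symm.map (copyDeleteEdges G u w).toHom)
  exact ⟨X ∪ Y, hX.union_of_deleteEdges hY huX hwY hwu.symm, .inl huX, .inr hvY⟩

theorem exists_isBridgeKernel_superset (hconn : G.Connected) (hG : ¬ ∃ v, IsInfiniteTrail G v)
    {S : Set V} (hS : S.Finite) : ∃ X, IsBridgeKernel G X ∧ S ⊆ X := by
  obtain ⟨u⟩ := hconn.nonempty
  have hkernel := fun v => exists_isBridgeKernel_of_reachable hG (hconn.preconnected u v)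
  suffices ∃ X, IsBridgeKernel G X ∧ u ∈ X ∧ S ⊆ X from
    let ⟨X, hX, _, hSX⟩ := this
    ⟨X, hX, hSX⟩
  induction S, hS using Set.Finite.induction_on with
  | empty =>
    obtain ⟨X, hX, huX, -⟩ := hkernel u
    exact ⟨X, hX, huX, Set.empty_subset X⟩
  | @insert v S _ _ ih =>
    obtain ⟨X, hX, huX, hSX⟩ := ih
    obtain ⟨Y, hY, huY, hvY⟩ := hkernel v
    exact ⟨X ∪ Y, hX.union hY ⟨u, huX, huY⟩, .inl huX,
      Set.insert_subset (.inr hvY) (hSX.trans Set.subset_union_left)⟩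

end BridgeKernel

section RankBound

theorem exists_lt_forall_rankLT {κ : Cardinal.{u}} (hκ : ℵ₀ ≤ κ) {ι : Type u} (hι : #ι ≤ κ)
    {V : ι → Type u} {G : ∀ i, SimpleGraph (V i)}
    (hG : ∀ i, RankLT (Order.succ κ).ord (G i)) :
    ∃ β < (Order.succ κ).ord, ∀ i, RankLT β (G i) := by
  have hlim : Order.IsSuccLimit (Order.succ κ).ord := isSuccLimit_ord (hκ.trans (Order.le_succ κ))
  choose β hβ hrank using fun i => rankLT_iff_exists_rankLT_succ.1 (hG i)
  refine ⟨⨆ i, Order.succ (β i), Ordinal.iSup_lt_of_lt_cof ?_ fun i => hlim.succ_lt (hβ i),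
    fun i => (hrank i).mono (Ordinal.le_iSup _ i)⟩
  rw [(isRegular_succ hκ).cof_ord]
  exact Order.lt_succ_iff.2 hι

theorem rankLT_of_not_isInfiniteTrail {κ : Cardinal.{u}} (hκ : ℵ₀ ≤ κ) {V : Type u} (hV : #V ≤ κ)
    {G : SimpleGraph V} (hG : ¬ ∃ v, IsInfiniteTrail G v) (u : V) :
    RankLT (Order.succ κ).ord (G.connectedComponentMk u).toSimpleGraph := by
  refine induction_on_trails (motive := fun G u =>
    RankLT (Order.succ κ).ord (G.connectedComponentMk u).toSimpleGraph) (fun G u ih => ?_) hG u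
  obtain ⟨β, hβ, hrank⟩ := exists_lt_forall_rankLT (ι := {w // G.Adj u w}) hκ
    ((mk_subtype_le _).trans hV) fun w => ih w w.2
  refine rankLT_iff_exists_rankLT_succ.2 ⟨β, hβ, rankLT_succ_iff_forall_connected.2
    ⟨{⟨u, rfl⟩}, Set.finite_singleton _, fun {W} T hT ⟨f⟩ => ?_⟩⟩
  let g : Copy T (G.induce {u}ᶜ) :=
    ⟨⟨fun x => ⟨(f x).1, fun h => (f x).2 (Subtype.ext h)⟩, f.toHom.map_rel⟩, fun _ _ hxy =>
      f.injective (Subtype.ext (Subtype.ext (Subtype.mk.inj hxy)))⟩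
  obtain ⟨t⟩ := hT.nonempty
  obtain ⟨p⟩ := ConnectedComponent.exact (f t).1.2
  obtain ⟨w, u', hu', htw, hwu, -⟩ := exists_edge_entering (X := {u}) p (g t).2 rfl
  obtain rfl : u = u' := hu'.symm
  let c := copyDeleteEdges G u (w : V)
  have htw' : (G.deleteEdges {s(u, ↑w)}).connectedComponentMk (c (g t)) =
      (G.deleteEdges {s(u, ↑w)}).connectedComponentMk ↑w :=
    ConnectedComponent.sound (htw.map c.toHom)
  exact (hrank ⟨w, hwu.symm⟩).of_isContained
    (htw' ▸ isContained_toSimpleGraph hT.preconnected (c.comp g) t)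

theorem rankLT_of_mem_trailFree {κ : Cardinal.{u}} (hκ : ℵ₀ ≤ κ) {G : BundledGraph.{u}}
    (hG : G ∈ trailFree κ) : RankLT (Order.succ κ).ord G.graph := by
  obtain ⟨hconn, hcard, htrail⟩ := hG
  obtain ⟨v⟩ := hconn.nonempty
  exact (rankLT_of_not_isInfiniteTrail hκ hcard htrail v).of_isContained
    (isContained_toSimpleGraph hconn.preconnected (.id _) v)

end RankBound

section Glue

variable {A I A' I' : Type*} {V : I → Type*} {V' : I' → Type*}

/-- The adjacency relation of `glue`. -/
inductive GlueAdj (B : SimpleGraph A) (H : ∀ i, SimpleGraph (V i)) (anchor : I → A)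
    (root : ∀ i, V i) : A ⊕ (Σ i, V i) → A ⊕ (Σ i, V i) → Prop
  | base {a b : A} (h : B.Adj a b) : GlueAdj B H anchor root (.inl a) (.inl b)
  | fiber {i : I} {z w : V i} (h : (H i).Adj z w) :
      GlueAdj B H anchor root (.inr ⟨i, z⟩) (.inr ⟨i, w⟩)
  | bridge (i : I) : GlueAdj B H anchor root (.inl (anchor i)) (.inr ⟨i, root i⟩)
  | bridge_symm (i : I) : GlueAdj B H anchor root (.inr ⟨i, root i⟩) (.inl (anchor i))

/-- The graph obtained from the disjoint union of `B` and the graphs `H i` by adding, for every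
`i`, a bridge between the vertex `anchor i` of `B` and the vertex `root i` of `H i`. -/
def glue (B : SimpleGraph A) (H : ∀ i, SimpleGraph (V i)) (anchor : I → A) (root : ∀ i, V i) :
    SimpleGraph (A ⊕ Σ i, V i) where
  Adj := GlueAdj B H anchor root
  symm := ⟨by
    rintro _ _ (h | h | i | i)
    exacts [.base h.symm, .fiber h.symm, .bridge_symm i, .bridge i]⟩
  loopless := ⟨by
    rintro _ (h | h)
    exacts [h.ne rfl, h.ne rfl]⟩

variable {B : SimpleGraph A} {H : ∀ i, SimpleGraph (V i)} {anchor : I → A} {root : ∀ i, V i}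
  {B' : SimpleGraph A'} {H' : ∀ i, SimpleGraph (V' i)} {anchor' : I' → A'} {root' : ∀ i, V' i}

theorem glue_adj_inl_inl {a b : A} : (glue B H anchor root).Adj (.inl a) (.inl b) ↔ B.Adj a b :=
  ⟨fun h => by cases h; assumption, .base⟩

theorem glue_adj_inl_inr {a : A} {i : I} {z : V i} :
    (glue B H anchor root).Adj (.inl a) (.inr ⟨i, z⟩) ↔ a = anchor i ∧ z = root i :=
  ⟨fun h => by cases h; exact ⟨rfl, rfl⟩, by rintro ⟨rfl, rfl⟩; exact .bridge i⟩

theorem glue_adj_inr_inr {i : I} {z w : V i} :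
    (glue B H anchor root).Adj (.inr ⟨i, z⟩) (.inr ⟨i, w⟩) ↔ (H i).Adj z w :=
  ⟨fun h => by cases h; assumption, .fiber⟩

theorem fst_eq_of_glue_adj_inr_inr {p q : Σ i, V i}
    (h : (glue B H anchor root).Adj (.inr p) (.inr q)) : p.1 = q.1 := by
  cases h
  rfl

variable (B H anchor root) in
/-- The inclusion of the base graph `B`. -/
def glueInl : B ↪g glue B H anchor root := ⟨.inl, glue_adj_inl_inl⟩

variable (B H anchor root) in
/-- The inclusion of the attached graph `H i`. -/
def glueInr (i : I) : H i ↪g glue B H anchor root :=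
  ⟨⟨fun z => .inr ⟨i, z⟩, Sum.inr_injective.comp sigma_mk_injective⟩, glue_adj_inr_inr⟩

theorem glue_connected (hB : B.Connected) (hH : ∀ i, (H i).Preconnected) :
    (glue B H anchor root).Connected := by
  obtain ⟨a⟩ := hB.nonempty
  have hbase : ∀ b, (glue B H anchor root).Reachable (.inl a) (.inl b) :=
    fun b => (hB.preconnected a b).map (glueInl B H anchor root).toHom
  refine (connected_iff_exists_forall_reachable _).2 ⟨.inl a, ?_⟩
  rintro (b | ⟨i, z⟩)
  · exact hbase b
  · have hbridge : (glue B H anchor root).Adj (.inl (anchor i)) (.inr ⟨i, root i⟩) := .bridge i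
    exact ((hbase _).trans hbridge.reachable).trans
      ((hH i (root i) z).map (glueInr B H anchor root i).toHom)

theorem exists_eq_inr_of_reachable_glue {y y' : ↥(Set.range (Sum.inl : A → A ⊕ Σ i, V i))ᶜ}
    {i : I} {z : V i} (hy : (y : A ⊕ Σ i, V i) = .inr ⟨i, z⟩)
    (h : ((glue B H anchor root).induce (Set.range Sum.inl)ᶜ).Reachable y y') :
    ∃ w, (y' : A ⊕ Σ i, V i) = .inr ⟨i, w⟩ := by
  rw [reachable_iff_reflTransGen] at h
  induction h with
  | refl => exact ⟨z, hy⟩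
  | @tail x y' _ hadj ih =>
    obtain ⟨w, hw⟩ := ih
    obtain ⟨b | ⟨j, z'⟩, hy'⟩ := y'
    · exact absurd ⟨b, rfl⟩ hy'
    · rw [induce_adj, hw] at hadj
      obtain rfl : i = j := fst_eq_of_glue_adj_inr_inr hadj
      exact ⟨z', rfl⟩

theorem glue_attachedByBridges :
    AttachedByBridges (glue B H anchor root) (Set.range Sum.inl) := by
  rintro _ _ ⟨a, rfl⟩ ⟨a', rfl⟩ ⟨b | ⟨i, z⟩, hy⟩ y' hyy' hadj hadj'
  · exact absurd ⟨b, rfl⟩ hy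
  · obtain ⟨z', hz'⟩ := exists_eq_inr_of_reachable_glue rfl hyy'
    rw [hz'] at hadj' ⊢
    obtain ⟨rfl, rfl⟩ := glue_adj_inl_inr.1 hadj
    obtain ⟨rfl, rfl⟩ := glue_adj_inl_inr.1 hadj'
    exact ⟨rfl, rfl⟩

theorem exists_forall_eq_inr_of_preconnected {W : Type*} {T : SimpleGraph W} [Nonempty W]
    (hT : T.Preconnected) (f : T →g (glue B H anchor root).induce (Set.range Sum.inl)ᶜ) :
    ∃ (i : I) (g : W → V i), ∀ x, (f x : A ⊕ Σ i, V i) = .inr ⟨i, g x⟩ := by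
  obtain ⟨t⟩ := ‹Nonempty W›
  rcases ht : (f t : A ⊕ Σ i, V i) with b | ⟨i, z⟩
  · exact absurd ⟨b, ht.symm⟩ (f t).2
  · choose g hg using fun x => exists_eq_inr_of_reachable_glue ht ((hT t x).map f)
    exact ⟨i, g, hg⟩

theorem glue_not_isInfiniteTrail [Finite A] (hH : ∀ i, ¬ ∃ v, IsInfiniteTrail (H i) v) :
    ¬ ∃ v, IsInfiniteTrail (glue B H anchor root) v := by
  rintro ⟨v, hv⟩
  obtain ⟨w, hw⟩ :=
    glue_attachedByBridges.exists_isInfiniteTrail_induce_compl (Set.finite_range _) hv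
  obtain ⟨i, z, hz⟩ := exists_forall_eq_inr_of_preconnected (T := hasse ℕ)
    (hasse_preconnected_of_succ ℕ) ⟨w, fun {m n} hmn => by
      rcases hasse_adj.1 hmn with h | h <;> obtain rfl := Order.succ_eq_iff_covBy.2 h
      exacts [hw.1 m, (hw.1 n).symm]⟩
  refine hH i ⟨z, (isInfiniteTrail_comp_iff (glueInr B H anchor root i)).1 ?_⟩
  convert (isInfiniteTrail_comp_iff (Embedding.induce _)).2 hw
  ext n
  exact (hz n).symm

theorem glue_rankLT {A I : Type u} {V : I → Type u} [Finite A] {B : SimpleGraph A}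
    {H : ∀ i, SimpleGraph (V i)} {anchor : I → A} {root : ∀ i, V i} {α : Ordinal.{u}}
    (hH : ∀ i, RankLT α (H i)) : RankLT (Order.succ α) (glue B H anchor root) := by
  refine rankLT_succ_iff_forall_connected.2
    ⟨Set.range .inl, Set.finite_range _, fun T hT ⟨f⟩ => ?_⟩
  have := hT.nonempty
  obtain ⟨i, g, hg⟩ := exists_forall_eq_inr_of_preconnected hT.preconnected f.toHom
  refine (hH i).of_isContained ⟨⟨⟨g, fun {x y} hxy => ?_⟩, fun x y (hxy : g x = g y) => ?_⟩⟩
  · have hadj := f.toHom.map_rel hxy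
    rw [induce_adj, hg, hg] at hadj
    exact glue_adj_inr_inr.1 hadj
  · exact f.injective (Subtype.ext ((hg x).trans (hxy ▸ (hg y).symm)))

theorem disjoint_range_glueInr {i j : I} (hij : i ≠ j) :
    Disjoint (Set.range (glueInr B H anchor root i)) (Set.range (glueInr B H anchor root j)) := by
  rw [Set.disjoint_left]
  rintro _ ⟨z, rfl⟩ ⟨w, hw⟩
  exact hij (congrArg Sigma.fst (Sum.inr_injective hw)).symm

/-- The embedding of glued graphs induced by an embedding `e` of the base graphs and embeddings
`Φ i` of the attached graphs, compatible with the bridges. -/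
def glueMap (e : B ↪g B') (σ : I ↪ I') (Φ : ∀ i, H i ↪g H' (σ i))
    (hanchor : ∀ i, anchor' (σ i) = e (anchor i)) (hroot : ∀ i, root' (σ i) = Φ i (root i)) :
    glue B H anchor root ↪g glue B' H' anchor' root' where
  toFun := Sum.map e (Sigma.map σ fun i => Φ i)
  inj' := e.injective.sumMap (σ.injective.sigma_map fun i => (Φ i).injective)
  map_rel_iff' := by
    have hbridge : ∀ a i (z : V i),
        (glue B' H' anchor' root').Adj (.inl (e a)) (.inr ⟨σ i, Φ i z⟩) ↔
          (glue B H anchor root).Adj (.inl a) (.inr ⟨i, z⟩) := fun a i z => by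
      rw [glue_adj_inl_inr, glue_adj_inl_inr, hanchor, hroot, e.injective.eq_iff,
        (Φ i).injective.eq_iff]
    rintro (a | ⟨i, z⟩) (b | ⟨j, w⟩)
    · exact glue_adj_inl_inl.trans (e.map_rel_iff.trans glue_adj_inl_inl.symm)
    · exact hbridge a j w
    · exact (adj_comm ..).trans ((hbridge b i z).trans (adj_comm ..))
    · by_cases hij : i = j
      · subst hij
        exact glue_adj_inr_inr.trans ((Φ i).map_rel_iff.trans glue_adj_inr_inr.symm)
      · exact iff_of_false (fun h => hij (σ.injective (fst_eq_of_glue_adj_inr_inr h)))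
          fun h => hij (fst_eq_of_glue_adj_inr_inr h)

/-- A graph in which every component of `G - X` is joined to `X` by exactly one edge, as a gluing
of these components to the graph induced by `X`. -/
noncomputable def glueComponentsIso {V : Type*} {G : SimpleGraph V} {X : Set V}
    (hX : AttachedByBridges G X) (anchor : (G.induce Xᶜ).ConnectedComponent → X)
    (root : ∀ C : (G.induce Xᶜ).ConnectedComponent, C.supp)
    (hadj : ∀ C, G.Adj (anchor C) (root C : ↥Xᶜ)) :
    glue (G.induce X) (fun C => (G.induce Xᶜ).induce C.supp) anchor root ≃g G where
  toEquiv := .ofBijective (Sum.elim Subtype.val fun p => (p.2 : ↥Xᶜ)) <| by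
    refine ⟨?_, fun a => ?_⟩
    · rintro (a | ⟨C, y, hy⟩) (b | ⟨D, z, hz⟩) h
      · exact congrArg _ (Subtype.ext h)
      · have haz : (a : V) = z := h
        exact absurd (haz ▸ a.2) z.2
      · have hyb : (y : V) = b := h
        exact absurd (hyb ▸ b.2) y.2
      · obtain rfl : y = z := Subtype.ext h
        obtain rfl : C = D := hy.symm.trans hz
        rfl
    · by_cases ha : a ∈ X
      · exact ⟨.inl ⟨a, ha⟩, rfl⟩
      · exact ⟨.inr ⟨(G.induce Xᶜ).connectedComponentMk ⟨a, ha⟩, ⟨⟨a, ha⟩, rfl⟩⟩, rfl⟩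
  map_rel_iff' := by
    have hbridge : ∀ (a : X) (C : (G.induce Xᶜ).ConnectedComponent) (z : C.supp),
        G.Adj a (z : ↥Xᶜ) ↔
          (glue (G.induce X) (fun C => (G.induce Xᶜ).induce C.supp) anchor root).Adj
            (.inl a) (.inr ⟨C, z⟩) := by
      intro a C z
      rw [glue_adj_inl_inr]
      refine ⟨fun h => ?_, by rintro ⟨rfl, rfl⟩; exact hadj C⟩
      exact (hX a.2 (anchor C).2 (ConnectedComponent.exact (z.2.trans (root C).2.symm)) h
        (hadj C)).imp Subtype.ext fun h => Subtype.ext (Subtype.ext h)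
    rintro (a | ⟨C, y⟩) (b | ⟨D, z⟩)
    · rw [glue_adj_inl_inl]
      rfl
    · exact hbridge a D z
    · exact (adj_comm ..).trans ((hbridge b C y).trans (adj_comm ..))
    · by_cases hCD : C = D
      · subst hCD
        rw [glue_adj_inr_inr]
        rfl
      · refine iff_of_false (fun h => hCD ?_) fun h => hCD (fst_eq_of_glue_adj_inr_inr h)
        have hyz : (G.induce Xᶜ).Adj y z := h
        exact y.2.symm.trans ((ConnectedComponent.sound hyz.reachable).trans z.2)

theorem exists_adj_connectedComponent {V : Type*} {G : SimpleGraph V} {X : Set V}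
    (hG : G.Preconnected) (hX : X.Nonempty) (C : (G.induce Xᶜ).ConnectedComponent) :
    ∃ (x : X) (y : C.supp), G.Adj x (y : ↥Xᶜ) := by
  obtain ⟨b, hb⟩ := hX
  obtain ⟨a, ha⟩ := C.nonempty_supp
  obtain ⟨p⟩ := hG a b
  obtain ⟨y, x, hx, hay, hyx, -⟩ := exists_edge_entering p a.2 hb
  exact ⟨⟨x, hx⟩, ⟨y, (ConnectedComponent.sound hay.symm).trans ha⟩, hyx.symm⟩

end Glue

section Ear

variable {V W : Type u} {G : SimpleGraph V} {H : SimpleGraph W} {K : G.Subgraph} {X : Set W}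

theorem exists_walk_map_eq {V W : Type*} {G : SimpleGraph V} {H : SimpleGraph W} (Φ : G ↪g H)
    {u v : V} (p : H.Walk (Φ u) (Φ v)) (hp : ∀ z ∈ p.support, z ∈ Set.range Φ) :
    ∃ q : G.Walk u v, q.map Φ.toHom = p := by
  suffices ∀ {x y : W} (p : H.Walk x y), (∀ z ∈ p.support, z ∈ Set.range Φ) →
      ∀ {u v : V} (hu : Φ u = x) (hv : Φ v = y), ∃ q : G.Walk u v, (q.map Φ.toHom).copy hu hv = p
    from this p hp rfl rfl
  intro x y p hp u v hu hv
  induction p generalizing u with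
  | nil =>
    subst hu
    obtain rfl := Φ.injective hv
    exact ⟨.nil, rfl⟩
  | cons h p ih =>
    subst hu
    obtain ⟨w, rfl⟩ := hp _ (List.mem_cons_of_mem _ p.start_mem_support)
    obtain ⟨q, rfl⟩ := ih (fun z hz => hp z (List.mem_cons_of_mem _ hz)) rfl hv
    subst hv
    exact ⟨.cons (Φ.map_rel_iff.1 h) q, rfl⟩

theorem apply_mem_verts_map_iff {V W : Type*} {G : SimpleGraph V} {H : SimpleGraph W}
    {K : G.Subgraph} (Φ : G ↪g H) {w : V} : Φ w ∈ (K.map Φ.toHom).verts ↔ w ∈ K.verts :=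
  Φ.injective.mem_set_image

theorem HasOpenEar.of_map (Φ : G ↪g H) (hX : AttachedByBridges H X) (hKX : Φ '' K.verts ⊆ X)
    (hXΦ : X ⊆ Set.range Φ) (h : HasOpenEar (K.map Φ.toHom)) : HasOpenEar K := by
  obtain ⟨x, y, p, hp, hne, hsupport, hedges⟩ := h
  obtain ⟨u, hu, rfl⟩ := (hsupport x p.start_mem_support).2 (.inl rfl)
  obtain ⟨v, hv, rfl⟩ := (hsupport y p.end_mem_support).2 (.inr rfl)
  obtain ⟨q, rfl⟩ := exists_walk_map_eq Φ p fun z hz =>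
    hXΦ (hX.support_subset (hKX ⟨u, hu, rfl⟩) (hKX ⟨v, hv, rfl⟩) hp.isTrail hz)
  refine ⟨u, v, q, (Walk.isPath_map_iff_of_injective Φ.injective).1 hp, ne_of_apply_ne Φ hne,
    fun w hw => ?_, fun e he heK => hedges (e.map Φ) ?_ ?_⟩
  · have hΦw : Φ w ∈ (q.map Φ.toHom).support := Walk.support_map _ q ▸ List.mem_map_of_mem hw
    rw [← apply_mem_verts_map_iff Φ, hsupport _ hΦw]
    exact or_congr Φ.injective.eq_iff Φ.injective.eq_iff
  · exact Walk.edges_map _ q ▸ List.mem_map_of_mem he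
  · exact Subgraph.edgeSet_map Φ.toHom K ▸ ⟨e, heK, rfl⟩

theorem HasClosedEar.of_map (Φ : G ↪g H) (hX : AttachedByBridges H X) (hKX : Φ '' K.verts ⊆ X)
    (hXΦ : X ⊆ Set.range Φ) (h : HasClosedEar (K.map Φ.toHom)) : HasClosedEar K := by
  obtain ⟨x, c, hc, hsupport⟩ := h
  obtain ⟨u, hu, rfl⟩ := (hsupport x c.start_mem_support).2 rfl
  obtain ⟨q, rfl⟩ := exists_walk_map_eq Φ c fun z hz =>
    hXΦ (hX.support_subset (hKX ⟨u, hu, rfl⟩) (hKX ⟨u, hu, rfl⟩) hc.isTrail hz)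
  refine ⟨u, q, (Walk.isCycle_map_iff_of_injective Φ.injective).1 hc, fun w hw => ?_⟩
  have hΦw : Φ w ∈ (q.map Φ.toHom).support := Walk.support_map _ q ▸ List.mem_map_of_mem hw
  rw [← apply_mem_verts_map_iff Φ, hsupport _ hΦw]
  exact Φ.injective.eq_iff

theorem HasEar.of_map (Φ : G ↪g H) (hX : AttachedByBridges H X) (hKX : Φ '' K.verts ⊆ X)
    (hXΦ : X ⊆ Set.range Φ) (h : HasEar (K.map Φ.toHom)) : HasEar K :=
  h.imp (.of_map Φ hX hKX hXΦ) (.of_map Φ hX hKX hXΦ)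

end Ear

section Cardinality

theorem mk_sigma_le {κ : Cardinal.{u}} (hκ : ℵ₀ ≤ κ) {I : Type u} {V : I → Type u} (hI : #I ≤ κ)
    (hV : ∀ i, #(V i) ≤ κ) : #(Σ i, V i) ≤ κ := by
  rw [mk_sigma]
  refine (sum_le_sum _ (fun _ => κ) hV).trans ?_
  rw [sum_const']
  exact mul_le_of_le hκ hI le_rfl

theorem mk_sum_sigma_le {κ : Cardinal.{u}} (hκ : ℵ₀ ≤ κ) {A I : Type u} {V : I → Type u}
    (hA : #A ≤ κ) (hI : #I ≤ κ) (hV : ∀ i, #(V i) ≤ κ) : #(A ⊕ Σ i, V i) ≤ κ := by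
  rw [mk_sum, lift_id, lift_id]
  exact add_le_of_le hκ hA (mk_sigma_le hκ hI hV)

end Cardinality

section StrongComplexity

variable {𝒞 F : Set BundledGraph.{u}}

theorem IsStronglyUniversal.strongComplexity_le (hF : IsStronglyUniversal F 𝒞) :
    strongComplexity 𝒞 ≤ #F :=
  csInf_le' ⟨F, hF, rfl⟩

theorem IsStronglyUniversal.le_strongComplexity (hF : IsStronglyUniversal F 𝒞)
    {c : Cardinal.{u + 1}} (hc : ∀ F', IsStronglyUniversal F' 𝒞 → c ≤ #F') :
    c ≤ strongComplexity 𝒞 :=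
  le_csInf ⟨_, F, hF, rfl⟩ fun _ ⟨F', hF', h⟩ => h ▸ hc F' hF'

end StrongComplexity

section EarUniversal

/-- `f` is a family of members of `𝒞` such that every `G ∈ 𝒞` with a finite subgraph `K` has a
strong immersion into some `f i` that creates no ears: the image of `K` has an ear only if `K` does.
-/
structure IsEarUniversal {ι : Type*} (f : ι → BundledGraph.{u}) (𝒞 : Set BundledGraph.{u}) :
    Prop where
  mem : ∀ i, f i ∈ 𝒞
  exists_embedding : ∀ G ∈ 𝒞, ∀ K : G.graph.Subgraph, K.verts.Finite →
    ∃ i, ∃ Φ : G.graph ↪g (f i).graph, HasEar (K.map Φ.toHom) → HasEar K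

theorem IsEarUniversal.nonempty_embedding {ι : Type*} {f : ι → BundledGraph.{u}}
    {𝒞 : Set BundledGraph.{u}} (h : IsEarUniversal f 𝒞) {G : BundledGraph.{u}} (hG : G ∈ 𝒞) :
    ∃ i, Nonempty (G.graph ↪g (f i).graph) :=
  let ⟨i, Φ, _⟩ := h.exists_embedding G hG ⊥ Set.finite_empty
  ⟨i, ⟨Φ⟩⟩

theorem IsEarUniversal.isStronglyUniversal_range {ι : Type*} {f : ι → BundledGraph.{u}}
    {𝒞 : Set BundledGraph.{u}} (h : IsEarUniversal f 𝒞) :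
    IsStronglyUniversal (Set.range f) 𝒞 :=
  ⟨Set.range_subset_iff.2 h.mem, fun _ hG => Set.exists_range_iff.2 (h.nonempty_embedding hG)⟩

theorem IsEarUniversal.sigma {J : Type*} {ι : J → Type*} {f : ∀ j, ι j → BundledGraph.{u}}
    {𝒞 : J → Set BundledGraph.{u}} (h : ∀ j, IsEarUniversal (f j) (𝒞 j)) :
    IsEarUniversal (fun i : Σ j, ι j => f i.1 i.2) (⋃ j, 𝒞 j) where
  mem i := Set.mem_iUnion.2 ⟨i.1, (h i.1).mem i.2⟩
  exists_embedding G hG K hK := by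
    obtain ⟨j, hG⟩ := Set.mem_iUnion.1 hG
    obtain ⟨i, hi⟩ := (h j).exists_embedding G hG K hK
    exact ⟨⟨j, i⟩, hi⟩

end EarUniversal

section AttachCopies

variable {ι A : Type u} {f : ι → BundledGraph.{u}} {κ : Cardinal.{u}} {α : Ordinal.{u}}
  {B : SimpleGraph A}

/-- The graph obtained from `B` by attaching, at every vertex of `B`, `κ` disjoint copies of every
member of the family `f` by a bridge to each of its vertices. -/
def attachCopies (κ : Cardinal.{u}) (f : ι → BundledGraph.{u}) (B : SimpleGraph A) :
    SimpleGraph (A ⊕ Σ i : A × (Σ j, (f j).V) × κ.out, (f i.2.1.1).V) :=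
  glue B (fun i => (f i.2.1.1).graph) (fun i => i.1) (fun i => i.2.1.2)

theorem attachCopies_mem_trailFree (hκ : ℵ₀ ≤ κ) (hι : #ι ≤ κ) (hf : ∀ j, f j ∈ trailFree κ)
    [Finite A] (hB : B.Connected) : ⟨_, attachCopies κ f B⟩ ∈ trailFree κ := by
  have hA : #A ≤ κ := (lt_aleph0_of_finite A).le.trans hκ
  have hindex : #(A × (Σ j, (f j).V) × κ.out) ≤ κ := by
    rw [mk_prod, mk_prod, lift_id, lift_id, lift_id, lift_id, mk_out]
    exact mul_le_of_le hκ hA (mul_le_of_le hκ (mk_sigma_le hκ hι fun j => (hf j).2.1) le_rfl)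
  exact ⟨glue_connected hB fun i => (hf i.2.1.1).1.preconnected,
    mk_sum_sigma_le hκ hA hindex fun i => (hf i.2.1.1).2.1,
    glue_not_isInfiniteTrail fun i => (hf i.2.1.1).2.2⟩

theorem attachCopies_mem_trailFreeBelow (hκ : ℵ₀ ≤ κ) (hι : #ι ≤ κ)
    (hf : ∀ j, f j ∈ trailFreeBelow κ α) [Finite A] (hB : B.Connected) :
    ⟨_, attachCopies κ f B⟩ ∈ trailFreeBelow κ (Order.succ α) :=
  ⟨attachCopies_mem_trailFree hκ hι (fun j => (hf j).1) hB, glue_rankLT fun i => (hf i.2.1.1).2⟩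

theorem exists_embedding_attachCopies {V : Type u} (hV : #V ≤ κ) {G : SimpleGraph V}
    (hG : G.Preconnected) {X : Set V} (hne : X.Nonempty) (hX : AttachedByBridges G X)
    (e : G.induce X ≃g B) (hf : ∀ C : (G.induce Xᶜ).ConnectedComponent,
      ∃ j, Nonempty ((G.induce Xᶜ).induce C.supp ↪g (f j).graph)) :
    ∃ Φ : G ↪g attachCopies κ f B, ∀ x : X, Φ x = .inl (e x) := by
  choose anchor root hadj using exists_adj_connectedComponent hG hne
  choose j hj using hf
  have Ψ := fun C => (hj C).some
  obtain ⟨c⟩ : Nonempty ((G.induce Xᶜ).ConnectedComponent ↪ κ.out) := by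
    rw [← Cardinal.le_def, mk_out]
    exact mk_quot_le.trans ((mk_subtype_le _).trans hV)
  let σ : (G.induce Xᶜ).ConnectedComponent ↪ A × (Σ j, (f j).V) × κ.out :=
    ⟨fun C => (e (anchor C), ⟨j C, Ψ C (root C)⟩, c C), fun C D hCD => c.injective (by simp_all)⟩
  let Φ : glue (G.induce X) (fun C => (G.induce Xᶜ).induce C.supp) anchor root ↪g
      attachCopies κ f B := glueMap e.toEmbedding σ Ψ (fun _ => rfl) fun _ => rfl
  let i := glueComponentsIso hX anchor root hadj
  refine ⟨Φ.comp i.symm.toEmbedding, fun x => ?_⟩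
  have hx : i (.inl x) = x := rfl
  rw [← hx]
  exact congrArg Φ (i.symm_apply_apply _)

theorem component_mem_trailFreeBelow {G : BundledGraph.{u}} (hG : G ∈ trailFree κ) {F X : Set G.V}
    (hFX : F ⊆ X) (hF : ∀ {W : Type u} (T : SimpleGraph W), T.Connected →
      T ⊑ G.graph.induce Fᶜ → RankLT α T) (C : (G.graph.induce Xᶜ).ConnectedComponent) :
    ⟨_, (G.graph.induce Xᶜ).induce C.supp⟩ ∈ trailFreeBelow κ α := by
  let Φ : (G.graph.induce Xᶜ).induce C.supp ↪g G.graph :=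
    (Embedding.induce Xᶜ).comp (Embedding.induce C.supp)
  have hFC : (G.graph.induce Xᶜ).induce C.supp ⊑ G.graph.induce Fᶜ :=
    ⟨((induceHomOfLE _ (Set.compl_subset_compl.2 hFX)).comp (Embedding.induce C.supp)).toCopy⟩
  exact ⟨⟨C.connected_toSimpleGraph, (mk_le_of_injective Φ.injective).trans hG.2.1,
    fun ⟨v, hv⟩ => hG.2.2 ⟨_, (isInfiniteTrail_comp_iff Φ).2 hv⟩⟩,
    hF _ C.connected_toSimpleGraph hFC⟩

theorem IsEarUniversal.exists_embedding_into_attachCopies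
    (hf : IsEarUniversal f (trailFreeBelow κ α)) {G : BundledGraph.{u}}
    (hG : G ∈ trailFreeBelow κ (Order.succ α)) {K : G.graph.Subgraph} (hK : K.verts.Finite) :
    ∃ (n : ℕ) (B : {B : SimpleGraph (ULift.{u} (Fin n)) // B.Connected})
      (Φ : G.graph ↪g attachCopies κ f B.1), HasEar (K.map Φ.toHom) → HasEar K := by
  obtain ⟨⟨hconn, hcard, htrail⟩, hrank⟩ := hG
  obtain ⟨F, hF, hFrank⟩ := rankLT_succ_iff_forall_connected.1 hrank
  obtain ⟨X, hX, hFKX⟩ := exists_isBridgeKernel_superset hconn htrail (hF.union hK)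
  have := hX.finite.to_subtype
  obtain ⟨n, ⟨e₀⟩⟩ := Finite.exists_equiv_fin X
  let e := Iso.map (e₀.trans Equiv.ulift.symm) (G.graph.induce X)
  obtain ⟨Φ, hΦ⟩ := exists_embedding_attachCopies hcard hconn.preconnected
    (Set.nonempty_coe_sort.1 hX.connected.nonempty) hX.attached e fun C => hf.nonempty_embedding
      (component_mem_trailFreeBelow ⟨hconn, hcard, htrail⟩
        (Set.subset_union_left.trans hFKX) hFrank C)
  refine ⟨n, ⟨_, e.connected_iff.1 hX.connected⟩, Φ, .of_map Φ glue_attachedByBridges ?_ ?_⟩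
  · rintro _ ⟨x, hx, rfl⟩
    exact ⟨_, (hΦ ⟨x, hFKX (.inr hx)⟩).symm⟩
  · rintro _ ⟨a, rfl⟩
    exact ⟨e.symm a, (hΦ _).trans (congrArg _ (e.apply_symm_apply a))⟩

theorem isEarUniversal_attachCopies (hκ : ℵ₀ ≤ κ) (hι : #ι ≤ κ)
    (hf : IsEarUniversal f (trailFreeBelow κ α)) :
    IsEarUniversal
      (fun B : Σ n : ℕ, {B : SimpleGraph (ULift.{u} (Fin n)) // B.Connected} =>
        ⟨_, attachCopies κ f B.2.1⟩) (trailFreeBelow κ (Order.succ α)) where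
  mem B := attachCopies_mem_trailFreeBelow hκ hι hf.mem B.2.2
  exists_embedding _ hG _ hK :=
    let ⟨n, B, hB⟩ := hf.exists_embedding_into_attachCopies hG hK
    ⟨⟨n, B⟩, hB⟩

theorem exists_mem_trailFree_isEmpty_embedding (hκ : ℵ₀ ≤ κ) (hι : #ι ≤ κ)
    (hf : ∀ j, f j ∈ trailFree κ) :
    ∃ G ∈ trailFree κ, ∀ j, IsEmpty (G.graph ↪g (f j).graph) := by
  refine ⟨⟨_, attachCopies κ f (⊥ : SimpleGraph PUnit)⟩,
    attachCopies_mem_trailFree hκ hι hf .of_subsingleton, fun j => ⟨fun Φ => ?_⟩⟩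
  have : Infinite κ.out := infinite_iff.2 (hκ.trans (mk_out κ).ge)
  obtain ⟨z⟩ := (hf j).1.nonempty
  let index (l : κ.out) : PUnit × (Σ j, (f j).V) × κ.out := (PUnit.unit, ⟨j, z⟩, l)
  have hindex : Function.Injective index := fun l m h => congrArg (fun i => i.2.2) h
  let copy (l : κ.out) : (f j).graph ↪g attachCopies κ f (⊥ : SimpleGraph PUnit) :=
    glueInr _ (fun i => (f i.2.1.1).graph) _ _ (index l)
  have hcopy : Pairwise (Function.onFun Disjoint fun l => Set.range (copy l)) :=
    fun l m hlm => disjoint_range_glueInr (B := ⊥) (H := fun i => (f i.2.1.1).graph)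
      (anchor := fun i => i.1) (root := fun i => i.2.1.2) (hindex.ne hlm)
  exact not_rankLT_of_disjoint_copies (hf j).1 (fun l => (copy l).toCopy) hcopy ⟨Φ.toCopy⟩
    (rankLT_of_mem_trailFree hκ (hf j))

end AttachCopies

section Families

variable {κ μ : Cardinal.{u}} {α : Ordinal.{u}}

theorem iUnion_trailFreeBelow_succ :
    ⋃ b : α.ToType, trailFreeBelow κ (Order.succ (Ordinal.ToType.toOrd b).1) =
      trailFreeBelow κ α := by
  ext G
  rw [Set.mem_iUnion]
  constructor
  · rintro ⟨b, hG, hrank⟩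
    exact ⟨hG, RankLT.mono hrank (Order.succ_le_of_lt (Ordinal.ToType.toOrd b).2)⟩
  · rintro ⟨hG, β, hβ, hrank⟩
    exact ⟨Ordinal.ToType.mk ⟨β, hβ⟩, hG, β, by simp, hrank⟩

theorem trailFreeBelow_succ_ord (hκ : ℵ₀ ≤ κ) :
    trailFreeBelow κ (Order.succ κ).ord = trailFree κ :=
  Set.Subset.antisymm (fun _ hG => hG.1) fun _ hG => ⟨hG, rankLT_of_mem_trailFree hκ hG⟩

theorem exists_isEarUniversal_trailFreeBelow_of_forall_lt (hμ : ℵ₀ ≤ μ) (hα : α.card ≤ μ)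
    (h : ∀ β < α, ∃ (ι : Type u) (f : ι → BundledGraph.{u}), #ι ≤ μ ∧
      IsEarUniversal f (trailFreeBelow κ (Order.succ β))) :
    ∃ (ι : Type u) (f : ι → BundledGraph.{u}), #ι ≤ μ ∧
      IsEarUniversal f (trailFreeBelow κ α) := by
  choose ι f hι hf using fun b : α.ToType => h (Ordinal.ToType.toOrd b).1 (Ordinal.ToType.toOrd b).2
  exact ⟨Σ b, ι b, fun i => f i.1 i.2, mk_sigma_le hμ ((mk_toType α).trans_le hα) hι,
    iUnion_trailFreeBelow_succ ▸ .sigma hf⟩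

theorem exists_isEarUniversal_trailFreeBelow_succ (hκ : ℵ₀ ≤ κ)
    (hα : α < (Order.succ κ).ord) : ∃ (ι : Type u) (f : ι → BundledGraph.{u}), #ι ≤ κ ∧
      IsEarUniversal f (trailFreeBelow κ (Order.succ α)) := by
  induction α using WellFoundedLT.induction with
  | ind α ih =>
    obtain ⟨ι, f, hι, hf⟩ := exists_isEarUniversal_trailFreeBelow_of_forall_lt hκ
      (Order.lt_succ_iff.1 (lt_ord.1 hα)) fun β hβ => ih β hβ (hβ.trans hα)
    exact ⟨_, _, mk_le_aleph0.trans hκ, isEarUniversal_attachCopies hκ hι hf⟩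

theorem exists_isEarUniversal_trailFreeBelow (hκ : ℵ₀ ≤ κ) (hα : α < (Order.succ κ).ord) :
    ∃ (ι : Type u) (f : ι → BundledGraph.{u}), #ι ≤ κ ∧ IsEarUniversal f (trailFreeBelow κ α) :=
  exists_isEarUniversal_trailFreeBelow_of_forall_lt hκ (Order.lt_succ_iff.1 (lt_ord.1 hα))
    fun _ hβ => exists_isEarUniversal_trailFreeBelow_succ hκ (hβ.trans hα)

theorem exists_isEarUniversal_trailFree (hκ : ℵ₀ ≤ κ) :
    ∃ (ι : Type u) (f : ι → BundledGraph.{u}), #ι ≤ Order.succ κ ∧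
      IsEarUniversal f (trailFree κ) := by
  rw [← trailFreeBelow_succ_ord hκ]
  refine exists_isEarUniversal_trailFreeBelow_of_forall_lt (hκ.trans (Order.le_succ κ))
    (card_ord _).le fun β hβ => ?_
  obtain ⟨ι, f, hι, hf⟩ := exists_isEarUniversal_trailFreeBelow_succ hκ hβ
  exact ⟨ι, f, hι.trans (Order.le_succ κ), hf⟩

theorem mk_range_le_lift_of_le {ι : Type u} {β : Type (u + 1)} (f : ι → β) (hι : #ι ≤ μ) :
    #(Set.range f) ≤ Cardinal.lift.{u + 1} μ := by
  have h := mk_range_le_lift (f := f)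
  rw [lift_id'.{u, u + 1}] at h
  exact h.trans (lift_le.2 hι)

theorem lift_succ_le_mk_of_isStronglyUniversal (hκ : ℵ₀ ≤ κ) {F : Set BundledGraph.{u}}
    (hF : IsStronglyUniversal F (trailFree κ)) :
    Cardinal.lift.{u + 1} (Order.succ κ) ≤ #F := by
  by_contra! hlt
  rw [lift_succ, Order.lt_succ_iff] at hlt
  obtain ⟨c, hcκ, hc⟩ := le_lift_iff.1 hlt
  have heq : Cardinal.lift.{u + 1} #c.out = Cardinal.lift.{u} #F := by
    rw [mk_out, hc, lift_id'.{u, u + 1}]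
  obtain ⟨e⟩ := lift_mk_eq'.1 heq
  obtain ⟨G, hG, hempty⟩ := exists_mem_trailFree_isEmpty_embedding hκ ((mk_out c).le.trans hcκ)
    fun i => hF.1 (e i).2
  obtain ⟨H, hH, ⟨Φ⟩⟩ := hF.2 G hG
  obtain ⟨i, hi⟩ := e.surjective ⟨H, hH⟩
  obtain rfl : (e i).1 = H := congrArg Subtype.val hi
  exact (hempty i).false Φ

theorem strongComplexity_trailFree (hκ : ℵ₀ ≤ κ) :
    strongComplexity (trailFree κ) = Cardinal.lift.{u + 1} (Order.succ κ) := by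
  obtain ⟨ι, f, hι, hf⟩ := exists_isEarUniversal_trailFree hκ
  have hrange := hf.isStronglyUniversal_range
  exact le_antisymm (hrange.strongComplexity_le.trans (mk_range_le_lift_of_le f hι))
    (hrange.le_strongComplexity fun _ hF => lift_succ_le_mk_of_isStronglyUniversal hκ hF)

end Families

theorem mainTheorem7 (κ : Cardinal.{u}) (hκ : ℵ₀ ≤ κ) :
    (∀ α : Ordinal.{u}, α ≠ 0 → α < (Order.succ κ).ord →
      ∃ F : Set BundledGraph.{u}, F ⊆ trailFreeBelow κ α ∧
        (∀ G ∈ trailFreeBelow κ α, ∀ K : G.graph.Subgraph, K.verts.Finite →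
          ∃ H ∈ F, ∃ Φ : G.graph ↪g H.graph,
            ¬ HasEar K → ¬ HasEar (K.map Φ.toHom)) ∧
        #F ≤ Cardinal.lift.{u + 1} κ) ∧
    strongComplexity (trailFree κ) = Cardinal.lift.{u + 1} (Order.succ κ) := by
  refine ⟨fun α _ hα => ?_, strongComplexity_trailFree hκ⟩
  obtain ⟨ι, f, hι, hf⟩ := exists_isEarUniversal_trailFreeBelow hκ hα
  refine ⟨Set.range f, Set.range_subset_iff.2 hf.mem, fun G hG K hK => ?_,
    mk_range_le_lift_of_le f hι⟩
  obtain ⟨i, Φ, hΦ⟩ := hf.exists_embedding G hG K hK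
  exact ⟨f i, Set.mem_range_self i, Φ, mt hΦ⟩
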